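/- **Theorem 3.3.** For real $p,q,r$ with $r\notin\{0,-1,-2,\dots\}$ and $0<x<1$ let ${}_2F_1(p,q;r;x)=\sum_{n\ge 0}\frac{(p)_n(q)_n}{n!\,(r)_n}x^n$. Let $P\subset\mathbb{R}^5$ be the set of $(a,b,p,q,r)$ such that $r\notin\{0,-1,-2,\dots\}$, ${}_2F_1(p,q;r;x)>0$ for all $x\in(0,1)$, and $a>0$, $b>0$, $r+b-p-q>0$. For $(a,b,p,q,r)\in P$, let $BH(a,b,p,q,r)$ be the probability distribution on $(0,1)$ with density proportional to $x^{a-1}(1-x)^{b-1}\,{}_2F_1(p,q;r;x)$. For $c,d>0$, let $\beta^{(2)}_{c,d}$ be the probability distribution on $(0,\infty)$ with density $\frac{1}{B(c,d)}\frac{w^{c-1}}{(1+w)^{c+d}}$. For $\theta=(\theta_1,\dots,\theta_5)\in\mathbb{R}^5$ put $$a=\theta_4+\theta_5,\quad b=\theta_1+\theta_3,\quad p=\theta_3+\theta_5,\quad q=\theta_3+\theta_4,\quad r=\theta_2+\theta_3+\theta_4+\theta_5 .$$ We say that $BH_\theta$ exists if $(a,b,p,q,r)\in P$, and then $BH_\theta=BH(a,b,p,q,r)$.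 For unordered pairs (multisets of size two), $Y\sim BH_{x,\{y,z\},\{u,v\}}$ means that $BH_{(x,y',z',u',v')}$ exists and is the law of $Y$ for each of the orderings $(y',z')$ of $\{y,z\}$ and $(u',v')$ of $\{u,v\}$. Suppose that $BH_\theta$ exists, that $\theta_2+\theta_3>0$, and that $X\sim BH_\theta$. 1. If $\theta_1+\theta_5>0$ and $W\sim\beta^{(2)}_{\theta_1+\theta_5,\,\theta_2+\theta_3}$ is independent of $X$, then $$\frac{1}{1+WX}\sim BH_{\theta_5,\{\theta_1,\theta_4\},\{\theta_2,\theta_3\}} .$$ 2. If $\theta_1+\theta_4>0$ and $W'\sim\beta^{(2)}_{\theta_1+\theta_4,\,\theta_2+\theta_3}$ is independent of $X$, then $$\frac{1}{1+W'X}\sim BH_{\theta_4,\{\theta_1,\theta_5\},\{\theta_2,\theta_3\}} .$$ In particular, the distributions on the right-hand sides exist. -/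

import Mathlib

open MeasureTheory ProbabilityTheory

namespace BetaHypergeometric

noncomputable section

/-- The function `h(a,b,p,q,r;x) = x^(a-1) (1-x)^(b-1) ₂F₁(p,q;r;x)`, used for `0 < x < 1`. -/
def h (a b p q r x : ℝ) : ℝ :=
  x ^ (a - 1) * (1 - x) ^ (b - 1) * ordinaryHypergeometric p q r x

/-- The set of parameters `(a,b,p,q,r)` for which the distribution `BH(a,b,p,q,r)` is defined. -/
def Admissible (a b p q r : ℝ) : Prop :=
  (∀ n : ℕ, r ≠ -(n : ℝ)) ∧
  (∀ x ∈ Set.Ioo (0 : ℝ) 1, 0 < ordinaryHypergeometric p q r x) ∧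
  0 < a ∧ 0 < b ∧ 0 < r + b - p - q

/-- The beta hypergeometric distribution `BH(a,b,p,q,r)`: the law on `(0,1)` whose density with
respect to Lebesgue measure is proportional to `h(a,b,p,q,r;·)`. It is meaningful for
admissible parameters. -/
def BH (a b p q r : ℝ) : Measure ℝ :=
  (∫⁻ x in Set.Ioo (0 : ℝ) 1, ENNReal.ofReal (h a b p q r x))⁻¹ •
    (volume.restrict (Set.Ioo (0 : ℝ) 1)).withDensity
      (fun x => ENNReal.ofReal (h a b p q r x))

/-- `BH_θ` exists: the parameters `(a,b,p,q,r)` attached to `θ`, namely `a = θ₄ + θ₅`,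
`b = θ₁ + θ₃`, `p = θ₃ + θ₅`, `q = θ₃ + θ₄`, `r = θ₂ + θ₃ + θ₄ + θ₅`, are admissible. -/
def AdmissibleTheta (θ₁ θ₂ θ₃ θ₄ θ₅ : ℝ) : Prop :=
  Admissible (θ₄ + θ₅) (θ₁ + θ₃) (θ₃ + θ₅) (θ₃ + θ₄) (θ₂ + θ₃ + θ₄ + θ₅)

/-- The distribution `BH_θ` of the `θ`-parameterisation. -/
def BHTheta (θ₁ θ₂ θ₃ θ₄ θ₅ : ℝ) : Measure ℝ :=
  BH (θ₄ + θ₅) (θ₁ + θ₃) (θ₃ + θ₅) (θ₃ + θ₄) (θ₂ + θ₃ + θ₄ + θ₅)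

/-- `Y ∼ BH_{x, s, t}` for a number `x` and two unordered pairs (multisets of size two) `s`, `t`:
for every way of writing `s = {y, z}` and `t = {u, v}`, the distribution `BH_{x,y,z,u,v}` exists
and it is the law of `Y`. -/
def HasBHLaw {Ω : Type*} [MeasurableSpace Ω] (Y : Ω → ℝ) (P : Measure Ω)
    (x : ℝ) (s t : Sym2 ℝ) : Prop :=
  ∀ y z u v : ℝ, s = s(y, z) → t = s(u, v) →
    AdmissibleTheta x y z u v ∧ HasLaw Y (BHTheta x y z u v) P

/-- The beta distribution of the second kind `β⁽²⁾_{c,d}`, for `c, d > 0`: the law on `(0,∞)` with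
density `w^(c-1) / (B(c,d) (1+w)^(c+d))`. -/
def betaTwo (c d : ℝ) : Measure ℝ :=
  (volume.restrict (Set.Ioi (0 : ℝ))).withDensity
    (fun w => ENNReal.ofReal (1 / ProbabilityTheory.beta c d * (w ^ (c - 1) / (1 + w) ^ (c + d))))

end

end BetaHypergeometric

namespace BetaHypergeometric

/-! Let W have parameters c, d. The density of X at x times the conditional density of U = 1/(1+WX)
at u is proportional to u^(d-1) (1-u)^(c-1) · x^(r-1) (1-x)^(b-1) ₂F₁(p,q;r;x) ·
(1-u(1-x))^(-(r+b-q)), because r = a+d and c+d = r+b-q (`kernel_identity`). The theorem thus rests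
on the integral over x being a multiple of ₂F₁(b, r+b-p-q; r+b-p; u) (`integral_kernel`).

Expanding the last factor in powers of u leaves the integrals of (1-x)^n against the weight. As the
exponent of x is r-1, integrating the series of ₂F₁ termwise gives sums that telescope, and
consecutive integrals satisfy a two-term recurrence (`integral_weight_succ`), which is the one that
generates the new coefficients. Integrability is read off from X having a probability law, so no
asymptotics of ₂F₁ at 1 are needed. The target law exists because the integrand is positive and the
recurrence forbids r+b-p from being a nonpositive integer.

The unordered pairs reflect two symmetries: p ↔ q exchanges θ₄ and θ₅, and Euler's transformation
exchanges θ₂ and θ₃. The first also deduces the second claim from the first. -/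

open Filter Topology

/-! ### The hypergeometric equation and its coefficient recurrence -/

open PowerSeries in
theorem coeff_X_mul_derivative {R : Type*} [CommRing R] (f : R⟦X⟧) (n : ℕ) :
    coeff n (X * derivative R f) = n * coeff n f := by
  cases n with
  | zero => simp
  | succ n => rw [coeff_succ_X_mul, coeff_derivative]; push_cast; ring

open PowerSeries in
/-- The hypergeometric differential equation for formal power series is the two-term recurrence
for the coefficients. -/
theorem hypergeometric_ode_iff {R : Type*} [CommRing R] (p q r : R) (f : R⟦X⟧) :
    X * (1 - X) * derivative R (derivative R f) + (C r - C (p + q + 1) * X) * derivative R f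
      - C (p * q) * f = 0 ↔
    ∀ n : ℕ, (n + 1) * (r + n) * coeff (n + 1) f = (p + n) * (q + n) * coeff n f := by
  -- With D = X d/dX, the part of the operator that preserves degree is (D+p)(D+q), which acts
  -- diagonally on coefficients.
  have key : X * (1 - X) * derivative R (derivative R f)
      + (C r - C (p + q + 1) * X) * derivative R f - C (p * q) * f =
      X * derivative R (derivative R f) + C r * derivative R f
      - X * derivative R (X * derivative R f) - C (p + q) * (X * derivative R f)
      - C (p * q) * f := by
    rw [Derivation.leibniz, derivative_X]
    simp only [map_add, map_one, smul_eq_mul]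
    ring
  rw [key, PowerSeries.ext_iff]
  refine forall_congr' fun n => ?_
  simp only [map_sub, LinearMap.map_add, coeff_C_mul, coeff_X_mul_derivative, coeff_derivative,
    map_zero]
  constructor
  · intro h; linear_combination h
  · intro h; linear_combination h

theorem ne_neg_natCast_of_pos {r : ℝ} (hr : 0 < r) (n : ℕ) : r ≠ -(n : ℝ) := fun hn => by
  have : (0 : ℝ) ≤ n := by positivity
  linarith

theorem ascPochhammer_ne_zero {r : ℝ} (hr : ∀ n : ℕ, r ≠ -(n : ℝ)) (n : ℕ) :
    (ascPochhammer ℝ n).eval r ≠ 0 := by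
  rw [Ne, ascPochhammer_eval_eq_zero_iff]
  rintro ⟨k, -, hk⟩
  exact hr k (by linarith)

theorem coefficient_succ {p q r : ℝ} (hr : ∀ n : ℕ, r ≠ -(n : ℝ)) (n : ℕ) :
    ((n : ℝ) + 1) * (r + n) * ordinaryHypergeometricCoefficient p q r (n + 1) =
      (p + n) * (q + n) * ordinaryHypergeometricCoefficient p q r n := by
  have h1 := ascPochhammer_ne_zero hr n
  have h2 : r + n ≠ 0 := fun h => hr n (by linarith)
  have h3 : (n.factorial : ℝ) ≠ 0 := by positivity
  have h4 : (n : ℝ) + 1 ≠ 0 := by positivity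
  simp only [ordinaryHypergeometricCoefficient, ascPochhammer_succ_eval, Nat.factorial_succ,
    Nat.cast_mul, Nat.cast_add, Nat.cast_one]
  field_simp

theorem eq_coefficient_of_recurrence {p q r : ℝ} (hr : ∀ n : ℕ, r ≠ -(n : ℝ)) {c : ℕ → ℝ}
    (h0 : c 0 = 1)
    (hc : ∀ n : ℕ, ((n : ℝ) + 1) * (r + n) * c (n + 1) = (p + n) * (q + n) * c n) (n : ℕ) :
    c n = ordinaryHypergeometricCoefficient p q r n := by
  induction n with
  | zero => simp [h0, ordinaryHypergeometricCoefficient]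
  | succ n ih =>
    have h2 : r + n ≠ 0 := fun h => hr n (by linarith)
    have h4 : (n : ℝ) + 1 ≠ 0 := by positivity
    refine mul_left_cancel₀ (mul_ne_zero h4 h2) ?_
    rw [hc, coefficient_succ hr, ih]

/-! ### Convergence on the unit interval and the binomial series -/

theorem radius_ge_one {p q r : ℝ} (hr : ∀ n : ℕ, r ≠ -(n : ℝ)) :
    1 ≤ (ordinaryHypergeometricSeries ℝ p q r).radius := by
  by_cases hp : ∃ n : ℕ, p = -(n : ℝ)
  · obtain ⟨n, rfl⟩ := hp
    rw [ordinaryHypergeometric_radius_top_of_neg_nat₁]; exact le_top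
  by_cases hq : ∃ n : ℕ, q = -(n : ℝ)
  · obtain ⟨n, rfl⟩ := hq
    rw [ordinaryHypergeometric_radius_top_of_neg_nat₂]; exact le_top
  push Not at hp hq
  rw [ordinaryHypergeometricSeries_radius_eq_one]
  exact fun k => ⟨fun h => hp k (by linarith), fun h => hq k (by linarith),
    fun h => hr k (by linarith)⟩

theorem mem_eball_radius {p q r : ℝ} (hr : ∀ n : ℕ, r ≠ -(n : ℝ)) {x : ℝ} (hx : |x| < 1) :
    x ∈ Metric.eball (0 : ℝ) (ordinaryHypergeometricSeries ℝ p q r).radius := by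
  refine Metric.eball_subset_eball (radius_ge_one hr) ?_
  rw [← ENNReal.ofReal_one, Metric.eball_ofReal]
  simpa using hx

theorem summable_norm_coefficient {p q r : ℝ} (hr : ∀ n : ℕ, r ≠ -(n : ℝ)) {x : ℝ}
    (hx : |x| < 1) :
    Summable fun n => ‖ordinaryHypergeometricCoefficient p q r n * x ^ n‖ := by
  have := (ordinaryHypergeometricSeries ℝ p q r).summable_norm_apply (mem_eball_radius hr hx)
  simpa only [ordinaryHypergeometricSeries_apply_eq, smul_eq_mul] using this

theorem hasSum_ordinaryHypergeometric {p q r : ℝ} (hr : ∀ n : ℕ, r ≠ -(n : ℝ)) {x : ℝ}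
    (hx : |x| < 1) :
    HasSum (fun n => ordinaryHypergeometricCoefficient p q r n * x ^ n)
      (ordinaryHypergeometric p q r x) := by
  have := (summable_norm_coefficient (p := p) (q := q) hr hx).of_norm.hasSum
  rwa [ordinaryHypergeometric_eq_tsum]

theorem continuousOn_ordinaryHypergeometric {p q r : ℝ} (hr : ∀ n : ℕ, r ≠ -(n : ℝ)) :
    ContinuousOn (ordinaryHypergeometric p q r) (Set.Ioo (0 : ℝ) 1) := by
  have hpos : 0 < (ordinaryHypergeometricSeries ℝ p q r).radius :=
    lt_of_lt_of_le one_pos (radius_ge_one hr)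
  refine ((ordinaryHypergeometricSeries ℝ p q r).hasFPowerSeriesOnBall hpos).continuousOn.mono ?_
  exact fun x hx => mem_eball_radius hr (abs_lt.2 ⟨by linarith [hx.1], hx.2⟩)

theorem ordinaryHypergeometric_symm (p q r : ℝ) :
    (ordinaryHypergeometric p q r : ℝ → ℝ) = ordinaryHypergeometric q p r := by
  unfold ordinaryHypergeometric
  rw [ordinaryHypergeometricSeries_symm]

theorem hasSum_one_sub_rpow (s : ℝ) {x : ℝ} (hx : |x| < 1) :
    HasSum (fun n => (ascPochhammer ℝ n).eval s / n.factorial * x ^ n) ((1 - x) ^ (-s)) := by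
  have h := (Real.one_div_one_sub_rpow_hasFPowerSeriesOnBall_zero s).hasSum (y := x) (by
    rw [← ENNReal.ofReal_one, Metric.eball_ofReal]
    simpa using hx)
  rw [zero_add, one_div, ← Real.rpow_neg (by linarith [(abs_lt.1 hx).2])] at h
  refine h.congr_fun fun n => ?_
  have h3 : (n.factorial : ℝ) ≠ 0 := by positivity
  rw [FormalMultilinearSeries.ofScalars_apply_eq, smul_eq_mul, ← Ring.multichoose_eq,
    ← Polynomial.ascPochhammer_smeval_eq_eval, ← Ring.factorial_nsmul_multichoose_eq_ascPochhammer,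
    nsmul_eq_mul, mul_div_cancel_left₀ _ h3]

theorem summable_norm_one_sub_rpow (s : ℝ) {x : ℝ} (hx : |x| < 1) :
    Summable fun n => ‖(ascPochhammer ℝ n).eval s / n.factorial * x ^ n‖ := by
  have h1 := ne_neg_natCast_of_pos one_pos
  -- The binomial series is ₂F₁(s,1;1;x).
  refine (summable_norm_coefficient (p := s) (q := 1) h1 hx).congr fun n => ?_
  rw [ordinaryHypergeometricCoefficient, mul_inv_cancel_right₀ (ascPochhammer_ne_zero h1 n)]
  ring_nf

/-! ### Euler's transformation -/

/-- Euler's transformation of the hypergeometric function. -/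
theorem ordinaryHypergeometric_euler {p q r : ℝ} (hr : ∀ n : ℕ, r ≠ -(n : ℝ)) {x : ℝ}
    (hx : |x| < 1) :
    ordinaryHypergeometric (r - p) (r - q) r x =
      (1 - x) ^ (p + q - r) * ordinaryHypergeometric p q r x := by
  set e := r - p - q with he
  set B : PowerSeries ℝ := PowerSeries.mk fun n => (ascPochhammer ℝ n).eval e / n.factorial
    with hB
  set F : PowerSeries ℝ := PowerSeries.mk (ordinaryHypergeometricCoefficient p q r) with hF
  have hD : (1 - PowerSeries.X) * PowerSeries.derivative ℝ B = PowerSeries.C e * B := by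
    ext n
    rw [sub_mul, one_mul, map_sub, coeff_X_mul_derivative, PowerSeries.coeff_derivative,
      PowerSeries.coeff_C_mul]
    simp only [hB, PowerSeries.coeff_mk, ascPochhammer_succ_eval, Nat.factorial_succ,
      Nat.cast_mul, Nat.cast_add, Nat.cast_one]
    have h3 : (n.factorial : ℝ) ≠ 0 := by positivity
    have h4 : (n : ℝ) + 1 ≠ 0 := by positivity
    field_simp
    ring
  -- B is the series of (1-x)^(-e). The product B F solves the equation with parameters r-p, r-q, r
  -- and has constant term 1, so the recurrence determines it.
  have hcoef : ∀ n, PowerSeries.coeff n (B * F) =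
      ordinaryHypergeometricCoefficient (r - p) (r - q) r n := by
    refine eq_coefficient_of_recurrence hr (by simp [hB, hF, ordinaryHypergeometricCoefficient]) ?_
    rw [← hypergeometric_ode_iff]
    have h3 := (hypergeometric_ode_iff p q r F).2 fun n => by
      simp only [hF, PowerSeries.coeff_mk]; exact coefficient_succ hr n
    have h2 := congrArg (PowerSeries.derivative ℝ) hD
    have hX : (1 - PowerSeries.X : PowerSeries ℝ) ≠ 0 := fun h => by
      simpa using congrArg PowerSeries.constantCoeff h
    -- The equation for B controls B' only through (1-X) B', hence the extra factor 1-X.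
    refine mul_left_cancel₀ hX ?_
    simp only [Derivation.leibniz, map_sub, map_add, map_mul, map_one, PowerSeries.derivative_X,
      PowerSeries.derivative_C, smul_eq_mul, PowerSeries.derivative_one, he] at h2 h3 hD ⊢
    generalize PowerSeries.derivative ℝ (PowerSeries.derivative ℝ B) = B2 at *
    generalize PowerSeries.derivative ℝ (PowerSeries.derivative ℝ F) = F2 at *
    generalize PowerSeries.derivative ℝ B = B1 at *
    generalize PowerSeries.derivative ℝ F = F1 at *
    generalize PowerSeries.C p = p at *
    generalize PowerSeries.C q = q at *
    generalize PowerSeries.C r = r at *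
    generalize (PowerSeries.X : PowerSeries ℝ) = X at *
    linear_combination (X * (1 - X) * F) * h2 + (1 - X) * B * h3 +
      (X * (r - p - q + 1) * F + (r - (r - p + (r - q) + 1) * X) * F + 2 * X * (1 - X) * F1) * hD
  rw [show p + q - r = -e by rw [he]; ring, ← (hasSum_one_sub_rpow e hx).tsum_eq,
    ← (hasSum_ordinaryHypergeometric (p := p) (q := q) hr hx).tsum_eq,
    ← (hasSum_ordinaryHypergeometric (p := r - p) (q := r - q) hr hx).tsum_eq,
    tsum_mul_tsum_eq_tsum_sum_antidiagonal_of_summable_norm (summable_norm_one_sub_rpow e hx)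
      (summable_norm_coefficient hr hx)]
  refine tsum_congr fun n => ?_
  rw [← hcoef, PowerSeries.coeff_mul, Finset.sum_mul]
  refine Finset.sum_congr rfl fun i hi => ?_
  replace hi : i.1 + i.2 = n := Finset.HasAntidiagonal.mem_antidiagonal.1 hi
  simp only [hB, hF, PowerSeries.coeff_mk, ← hi, pow_add]
  ring

/-! ### Beta integrals, termwise integration and contiguity -/

theorem integrableOn_beta {α β : ℝ} (hα : 0 < α) (hβ : 0 < β) :
    IntegrableOn (fun x : ℝ => x ^ (α - 1) * (1 - x) ^ (β - 1)) (Set.Ioo 0 1) ∧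
      ∫ x in Set.Ioo (0 : ℝ) 1, x ^ (α - 1) * (1 - x) ^ (β - 1) = beta α β := by
  have hB := beta_pos hα hβ
  have hm := measurable_betaPDFReal α β
  have h0 : 0 ≤ᵐ[volume] betaPDFReal α β := ae_of_all _ fun x => by
    by_cases hx : 0 < x ∧ x < 1
    · exact (betaPDFReal_pos hx.1 hx.2 hα hβ).le
    · simp [betaPDFReal, hx]
  have hl := lintegral_betaPDF_eq_one hα hβ
  have hint : Integrable (betaPDFReal α β) :=
    ⟨hm.aestronglyMeasurable, by
      rw [hasFiniteIntegral_iff_ofReal h0]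
      exact hl.trans_lt ENNReal.one_lt_top⟩
  have h1 : ∫ x, betaPDFReal α β x = 1 := by
    rw [integral_eq_lintegral_of_nonneg_ae h0 hm.aestronglyMeasurable]
    change (∫⁻ x, betaPDF α β x).toReal = 1
    rw [hl, ENNReal.toReal_one]
  have heq : betaPDFReal α β = (Set.Ioo (0 : ℝ) 1).indicator
      fun x => (beta α β)⁻¹ * (x ^ (α - 1) * (1 - x) ^ (β - 1)) := by
    ext x
    by_cases hx : x ∈ Set.Ioo (0 : ℝ) 1
    · rw [Set.indicator_of_mem hx, betaPDFReal, if_pos (Set.mem_Ioo.1 hx)]; ring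
    · rw [Set.indicator_of_notMem hx, betaPDFReal, if_neg (mt Set.mem_Ioo.2 hx)]
  rw [heq] at hint h1
  rw [integrable_indicator_iff measurableSet_Ioo] at hint
  rw [integral_indicator measurableSet_Ioo, integral_const_mul] at h1
  refine ⟨?_, by field_simp at h1; exact h1⟩
  have := hint.const_mul (beta α β)
  simp only [mul_inv_cancel_left₀ hB.ne'] at this
  exact this

theorem beta_succ_left {α β : ℝ} (hα : 0 < α) (hβ : 0 < β) :
    (α + β) * beta (α + 1) β = α * beta α β := by
  rw [beta, beta, Real.Gamma_add_one hα.ne', show α + 1 + β = α + β + 1 by ring,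
    Real.Gamma_add_one (by positivity)]
  have := (Real.Gamma_pos_of_pos (add_pos hα hβ)).ne'
  field_simp

theorem beta_succ_right {α β : ℝ} (hα : 0 < α) (hβ : 0 < β) :
    (α + β) * beta α (β + 1) = β * beta α β := by
  rw [beta, beta, Real.Gamma_add_one hβ.ne', ← add_assoc,
    Real.Gamma_add_one (by positivity)]
  have := (Real.Gamma_pos_of_pos (add_pos hα hβ)).ne'
  field_simp

/-- Once n exceeds |p|+|q|+|r|, the factors p+n, q+n, r+n are positive and the recurrence preserves
sign. This turns integrability of the sum into absolute summability of the integrals. -/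
theorem exists_sign_coefficient {p q r : ℝ} (hr : ∀ n : ℕ, r ≠ -(n : ℝ)) :
    ∃ (N : ℕ) (ε : ℝ), |ε| = 1 ∧ ∀ n : ℕ,
      |ordinaryHypergeometricCoefficient p q r (N + n)| =
        ε * ordinaryHypergeometricCoefficient p q r (N + n) := by
  obtain ⟨N, hN⟩ := exists_nat_gt (|p| + |q| + |r|)
  have hpos : ∀ n : ℕ, 0 < p + (N + n : ℕ) ∧ 0 < q + (N + n : ℕ) ∧ 0 < r + (N + n : ℕ) := by
    intro n
    have : (0 : ℝ) ≤ n := by positivity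
    push_cast
    have := neg_abs_le p
    have := neg_abs_le q
    have := neg_abs_le r
    have := abs_nonneg p
    have := abs_nonneg q
    have := abs_nonneg r
    refine ⟨?_, ?_, ?_⟩ <;> linarith
  have hstep : ∀ (ε : ℝ) (n : ℕ), 0 ≤ ε * ordinaryHypergeometricCoefficient p q r (N + n) →
      0 ≤ ε * ordinaryHypergeometricCoefficient p q r (N + n + 1) := by
    intro ε n h
    obtain ⟨h1, h2, h3⟩ := hpos n
    have hc := coefficient_succ (p := p) (q := q) hr (N + n)
    have h4 : 0 < ((N + n : ℕ) : ℝ) + 1 := by positivity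
    refine nonneg_of_mul_nonneg_right (a := (((N + n : ℕ) : ℝ) + 1) * (r + (N + n : ℕ))) ?_
      (mul_pos h4 h3)
    rw [mul_left_comm, hc, mul_left_comm]
    exact mul_nonneg (mul_nonneg h1.le h2.le) h
  have hall : ∀ ε : ℝ, 0 ≤ ε * ordinaryHypergeometricCoefficient p q r N →
      ∀ n : ℕ, 0 ≤ ε * ordinaryHypergeometricCoefficient p q r (N + n) := by
    intro ε h n
    induction n with
    | zero => exact h
    | succ n ih => exact hstep ε n ih
  rcases le_total 0 (ordinaryHypergeometricCoefficient p q r N) with h | h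
  · refine ⟨N, 1, by simp, fun n => ?_⟩
    have := hall 1 (by linarith) n
    rw [one_mul] at this ⊢
    exact abs_of_nonneg this
  · refine ⟨N, -1, by simp, fun n => ?_⟩
    have := hall (-1) (by linarith) n
    rw [abs_of_nonpos (by linarith)]
    ring

/-- A nonzero limit would make the harmonic series summable by comparison. This removes the boundary
term of the telescoping sum. -/
theorem eq_zero_of_tendsto_mul_of_summable {T : ℕ → ℝ} (hT : Summable T) {L : ℝ}
    (hL : Tendsto (fun n : ℕ => (n : ℝ) * T n) atTop (𝓝 L)) : L = 0 := by
  by_contra hne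
  refine Real.not_summable_one_div_natCast (summable_of_isBigO_nat hT ?_)
  refine Asymptotics.IsBigO.of_bound (2 / |L|) ?_
  have hL' := hL.abs.eventually (lt_mem_nhds (show |L| / 2 < |L| by
    have := abs_pos.2 hne; linarith))
  filter_upwards [hL', eventually_gt_atTop 0] with n hn hn0
  have hn1 : (0 : ℝ) < n := by exact_mod_cast hn0
  have := abs_pos.2 hne
  rw [abs_mul, abs_of_pos hn1] at hn
  rw [Real.norm_eq_abs, Real.norm_eq_abs, abs_of_pos (by positivity), div_le_iff₀ hn1,
    div_mul_eq_mul_div, div_mul_eq_mul_div, le_div_iff₀ this]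
  nlinarith

/-- Termwise integration of `x^(r-1) (1-x)^(b-1) ₂F₁(p,q;r;x)`. -/
theorem hasSum_integral_weight {p q r b : ℝ} (hr : 0 < r) (hb : 0 < b)
    (hint : IntegrableOn (h r b p q r) (Set.Ioo 0 1)) :
    HasSum (fun n : ℕ => ordinaryHypergeometricCoefficient p q r n * beta (r + n) b)
      (∫ x in Set.Ioo (0 : ℝ) 1, h r b p q r x) := by
  have hr' := ne_neg_natCast_of_pos hr
  set c := ordinaryHypergeometricCoefficient p q r with hc
  set f : ℕ → ℝ → ℝ := fun n x => c n * (x ^ (r + n - 1) * (1 - x) ^ (b - 1)) with hf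
  have hrn : ∀ n : ℕ, 0 < r + n := fun n => by positivity
  have hfint : ∀ n, Integrable (f n) (volume.restrict (Set.Ioo 0 1)) := fun n =>
    (integrableOn_beta (hrn n) hb).1.const_mul _
  have hfval : ∀ n, ∫ x in Set.Ioo (0 : ℝ) 1, f n x = c n * beta (r + n) b := fun n => by
    rw [integral_const_mul, (integrableOn_beta (hrn n) hb).2]
  have hfabs : ∀ n, ∫ x in Set.Ioo (0 : ℝ) 1, ‖f n x‖ = |c n| * beta (r + n) b := fun n => by
    rw [← (integrableOn_beta (hrn n) hb).2, ← integral_const_mul]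
    refine setIntegral_congr_fun measurableSet_Ioo fun x hx => ?_
    have h1 : 0 < 1 - x := by linarith [hx.2]
    have h2 := hx.1
    simp only [hf, norm_mul, Real.norm_eq_abs]
    rw [abs_of_pos (Real.rpow_pos_of_pos h2 _), abs_of_pos (Real.rpow_pos_of_pos h1 _)]
  have hsum : ∀ x ∈ Set.Ioo (0 : ℝ) 1, HasSum (fun n => f n x) (h r b p q r x) := by
    intro x hx
    have := (hasSum_ordinaryHypergeometric (p := p) (q := q) hr'
      (abs_lt.2 ⟨by linarith [hx.1], hx.2⟩)).mul_left (x ^ (r - 1) * (1 - x) ^ (b - 1))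
    refine this.congr_fun fun n => ?_
    simp only [hf]
    rw [show r + n - 1 = (r - 1) + n by ring, Real.rpow_add_natCast hx.1.ne']
    ring
  -- Beyond N all terms have one sign ε, so partial sums of their norms are bounded by the absolute
  -- value of the tail, an integrable function.
  have hS : Summable fun n => |c n| * beta (r + n) b := by
    obtain ⟨N, ε, hε, hN⟩ := exists_sign_coefficient (p := p) (q := q) hr'
    rw [← summable_nat_add_iff N]
    have hg : Integrable (fun x => h r b p q r x - ∑ i ∈ Finset.range N, f i x)
        (volume.restrict (Set.Ioo 0 1)) :=
      hint.sub (integrable_finsetSum _ fun i _ => hfint i)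
    refine summable_of_sum_range_le
      (c := ∫ x in Set.Ioo (0 : ℝ) 1, |h r b p q r x - ∑ i ∈ Finset.range N, f i x|)
      (fun n => mul_nonneg (abs_nonneg _) (beta_pos (hrn _) hb).le) fun M => ?_
    simp_rw [← hfabs]
    rw [← integral_finsetSum _ fun i _ => (hfint _).norm]
    refine setIntegral_mono_on (integrable_finsetSum _ fun i _ => (hfint _).norm) hg.abs
      measurableSet_Ioo fun x hx => ?_
    have h1 : 0 < 1 - x := by linarith [hx.2]
    have h2 := hx.1
    have hnorm : ∀ n, ‖f (n + N) x‖ = ε * f (n + N) x := fun n => by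
      simp only [hf, norm_mul, Real.norm_eq_abs]
      rw [abs_of_pos (Real.rpow_pos_of_pos h2 _), abs_of_pos (Real.rpow_pos_of_pos h1 _),
        add_comm n N, hN]
      ring
    have hs := ((hasSum_nat_add_iff' N).2 (hsum x hx)).mul_left ε
    calc ∑ i ∈ Finset.range M, ‖f (i + N) x‖
        = ∑ i ∈ Finset.range M, ε * f (i + N) x := Finset.sum_congr rfl fun i _ => hnorm i
      _ ≤ ε * (h r b p q r x - ∑ i ∈ Finset.range N, f i x) :=
          sum_le_hasSum _ (fun i _ => by rw [← hnorm]; exact norm_nonneg _) hs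
      _ ≤ _ := by
          refine (le_abs_self _).trans ?_
          rw [abs_mul, hε, one_mul]
  have := hasSum_integral_of_summable_integral_norm hfint (by simpa only [hfabs] using hS)
  simp only [hfval] at this
  rwa [setIntegral_congr_fun measurableSet_Ioo fun x hx => (hsum x hx).tsum_eq] at this

theorem integrableOn_weight_succ {a b p q r : ℝ}
    (hint : IntegrableOn (h a b p q r) (Set.Ioo 0 1)) :
    IntegrableOn (h a (b + 1) p q r) (Set.Ioo 0 1) := by
  have : IntegrableOn (fun x => h a b p q r x * (1 - x)) (Set.Ioo 0 1) := by
    refine hint.mul_bdd (c := 1) (by fun_prop) ?_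
    refine (ae_restrict_iff' measurableSet_Ioo).2 (ae_of_all _ fun x hx => ?_)
    rw [Real.norm_eq_abs, abs_of_pos (by linarith [hx.2])]
    linarith [hx.1]
  refine this.congr_fun (fun x hx => ?_) measurableSet_Ioo
  have h1 : 0 < 1 - x := by linarith [hx.2]
  simp only [h]
  rw [show b + 1 - 1 = (b - 1) + 1 by ring, Real.rpow_add_one h1.ne']
  ring

/-- The contiguity relation behind Gauss's summation theorem, in integral form. -/
theorem integral_weight_succ {p q r b : ℝ} (hr : 0 < r) (hb : 0 < b)
    (hint : IntegrableOn (h r b p q r) (Set.Ioo 0 1)) :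
    (r + b - p) * (r + b - q) * ∫ x in Set.Ioo (0 : ℝ) 1, h r (b + 1) p q r x =
      b * (r + b - p - q) * ∫ x in Set.Ioo (0 : ℝ) 1, h r b p q r x := by
  have hr' := ne_neg_natCast_of_pos hr
  have h1 := hasSum_integral_weight hr hb hint
  have h2 := hasSum_integral_weight hr (by positivity) (integrableOn_weight_succ hint)
  set T : ℕ → ℝ := fun n => ordinaryHypergeometricCoefficient p q r n * beta (r + n) b with hT
  have h3 := (h2.mul_left ((r + b - p) * (r + b - q))).sub (h1.mul_left (b * (r + b - p - q)))
  -- The factor r+n from the coefficient recurrence cancels the one from shifting the beta function;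
  -- this is where the exponent r-1 of x matters.
  have htel : ∀ n : ℕ, (r + b - p) * (r + b - q) *
      (ordinaryHypergeometricCoefficient p q r n * beta (r + n) (b + 1)) -
      b * (r + b - p - q) * T n = b * (((n + 1 : ℕ) : ℝ) * T (n + 1) - n * T n) := by
    intro n
    have hrn : 0 < r + n := by positivity
    have e1 := beta_succ_left hrn hb
    have e2 := beta_succ_right hrn hb
    have e3 := coefficient_succ (p := p) (q := q) hr' n
    have hne : r + n + b ≠ 0 := by positivity
    have hne' : r + n ≠ 0 := by positivity
    refine mul_left_cancel₀ hne (mul_left_cancel₀ hne' ?_)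
    simp only [hT]
    push_cast
    rw [← add_assoc]
    linear_combination (r + b - p) * (r + b - q) * ordinaryHypergeometricCoefficient p q r n *
      (r + n) * e2 - b * (n + 1) * ordinaryHypergeometricCoefficient p q r (n + 1) * (r + n) * e1 -
      b * (r + n) * beta (r + n) b * e3
  have hlim : Tendsto (fun n : ℕ => b * ((n : ℝ) * T n)) atTop
      (𝓝 ((r + b - p) * (r + b - q) * (∫ x in Set.Ioo (0 : ℝ) 1, h r (b + 1) p q r x) -
      b * (r + b - p - q) * ∫ x in Set.Ioo (0 : ℝ) 1, h r b p q r x)) := by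
    refine h3.tendsto_sum_nat.congr fun n => ?_
    rw [Finset.sum_congr rfl fun i _ => htel i, ← Finset.mul_sum,
      Finset.sum_range_sub (fun n : ℕ => (n : ℝ) * T n)]
    simp
  have hlim' : Tendsto (fun n : ℕ => (n : ℝ) * (b * T n)) atTop
      (𝓝 ((r + b - p) * (r + b - q) * (∫ x in Set.Ioo (0 : ℝ) 1, h r (b + 1) p q r x) -
      b * (r + b - p - q) * ∫ x in Set.Ioo (0 : ℝ) 1, h r b p q r x)) :=
    hlim.congr fun n => by ring
  exact sub_eq_zero.1 (eq_zero_of_tendsto_mul_of_summable (h1.summable.mul_left b) hlim')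

theorem continuousOn_h {a b p q r : ℝ} (hr : ∀ n : ℕ, r ≠ -(n : ℝ)) :
    ContinuousOn (h a b p q r) (Set.Ioo 0 1) := by
  refine ContinuousOn.mul (ContinuousOn.mul ?_ ?_) (continuousOn_ordinaryHypergeometric hr)
  · exact continuousOn_id.rpow_const fun x hx => Or.inl hx.1.ne'
  · exact (continuousOn_const.sub continuousOn_id).rpow_const fun x hx =>
      Or.inl (sub_pos.2 hx.2).ne'

theorem h_pos {a b p q r x : ℝ} (hF : 0 < ordinaryHypergeometric p q r x)
    (hx : x ∈ Set.Ioo (0 : ℝ) 1) : 0 < h a b p q r x :=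
  mul_pos (mul_pos (Real.rpow_pos_of_pos hx.1 _) (Real.rpow_pos_of_pos (sub_pos.2 hx.2) _)) hF

theorem setIntegral_Ioo_pos {f : ℝ → ℝ} (hf : ∀ x ∈ Set.Ioo (0 : ℝ) 1, 0 < f x)
    (hint : IntegrableOn f (Set.Ioo 0 1)) : 0 < ∫ x in Set.Ioo (0 : ℝ) 1, f x := by
  rw [setIntegral_pos_iff_support_of_nonneg_ae
    (ae_restrict_of_forall_mem measurableSet_Ioo fun x hx => (hf x hx).le) hint,
    Set.inter_eq_right.2 fun x hx => Function.mem_support.2 (hf x hx).ne']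
  simp

/-! ### The Euler-type integral -/

section Kernel

variable {p q r b : ℝ}

theorem integrableOn_weight_add (hint : IntegrableOn (h r b p q r) (Set.Ioo 0 1)) (n : ℕ) :
    IntegrableOn (h r (b + n) p q r) (Set.Ioo 0 1) := by
  induction n with
  | zero => simpa using hint
  | succ n ih =>
    have := integrableOn_weight_succ ih
    rwa [add_assoc, ← Nat.cast_succ] at this

theorem integral_weight_pos (hF : ∀ x ∈ Set.Ioo (0 : ℝ) 1, 0 < ordinaryHypergeometric p q r x)
    (hint : IntegrableOn (h r b p q r) (Set.Ioo 0 1)) (n : ℕ) :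
    0 < ∫ x in Set.Ioo (0 : ℝ) 1, h r (b + n) p q r x :=
  setIntegral_Ioo_pos (fun x hx => h_pos (hF x hx) hx) (integrableOn_weight_add hint n)

theorem integral_weight_add_succ (hr : 0 < r) (hb : 0 < b)
    (hint : IntegrableOn (h r b p q r) (Set.Ioo 0 1)) (n : ℕ) :
    (r + b - p + n) * (r + b - q + n) *
        ∫ x in Set.Ioo (0 : ℝ) 1, h r (b + (n + 1 : ℕ)) p q r x =
      (b + n) * (r + b - p - q + n) * ∫ x in Set.Ioo (0 : ℝ) 1, h r (b + n) p q r x := by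
  have := integral_weight_succ (b := b + n) hr (by positivity) (integrableOn_weight_add hint n)
  rw [add_assoc b, ← Nat.cast_succ] at this
  rw [show r + b - p + n = r + (b + n) - p by ring, show r + b - q + n = r + (b + n) - q by ring,
    show r + b - p - q + n = r + (b + n) - p - q by ring]
  exact this

/-- If r+b-p = -n, the recurrence at n has left side zero and right side positive. -/
theorem ne_neg_natCast_of_weight (hr : 0 < r) (hb : 0 < b) (hm : 0 < r + b - p - q)
    (hF : ∀ x ∈ Set.Ioo (0 : ℝ) 1, 0 < ordinaryHypergeometric p q r x)
    (hint : IntegrableOn (h r b p q r) (Set.Ioo 0 1)) (n : ℕ) : r + b - p ≠ -(n : ℝ) := by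
  intro hn
  have h1 := integral_weight_add_succ hr hb hint n
  have h2 := integral_weight_pos hF hint n
  rw [show r + b - p + n = 0 by linarith, zero_mul, zero_mul] at h1
  have : 0 < (b + n) * (r + b - p - q + n) * ∫ x in Set.Ioo (0 : ℝ) 1, h r (b + n) p q r x := by
    positivity
  exact this.ne h1

/-- Iterating the contiguity relation puts (r+b-q)_n in the denominator, where the binomial
coefficient of the kernel cancels it. -/
theorem integral_weight_add (hr : 0 < r) (hb : 0 < b)
    (hp : ∀ n : ℕ, r + b - p ≠ -(n : ℝ))
    (hint : IntegrableOn (h r b p q r) (Set.Ioo 0 1)) (n : ℕ) :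
    (ascPochhammer ℝ n).eval (r + b - q) / n.factorial *
        ∫ x in Set.Ioo (0 : ℝ) 1, h r (b + n) p q r x =
      (∫ x in Set.Ioo (0 : ℝ) 1, h r b p q r x) *
        ordinaryHypergeometricCoefficient b (r + b - p - q) (r + b - p) n := by
  induction n with
  | zero => simp [ordinaryHypergeometricCoefficient, mul_comm]
  | succ n ih =>
    have h1 := integral_weight_add_succ hr hb hint n
    have h2 := coefficient_succ (p := b) (q := r + b - p - q) hp n
    have h3 : r + b - p + n ≠ 0 := fun h => hp n (by linarith)
    have h4 : (n : ℝ) + 1 ≠ 0 := by positivity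
    have h5 : (n.factorial : ℝ) ≠ 0 := by positivity
    refine mul_left_cancel₀ (mul_ne_zero h4 h3) ?_
    rw [mul_left_comm _ (∫ x in Set.Ioo (0 : ℝ) 1, h r b p q r x), h2,
      mul_left_comm (∫ x in Set.Ioo (0 : ℝ) 1, h r b p q r x), ← ih,
      ascPochhammer_succ_eval, Nat.factorial_succ]
    push_cast at h1 ⊢
    field_simp
    linear_combination (ascPochhammer ℝ n).eval (r + b - q) * h1

theorem integrableOn_kernel (hint : IntegrableOn (h r b p q r) (Set.Ioo 0 1)) {s u : ℝ}
    (hu : u ∈ Set.Ioo (0 : ℝ) 1) :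
    IntegrableOn (fun x => h r b p q r x * (1 - u * (1 - x)) ^ (-s)) (Set.Ioo 0 1) := by
  have hcont : ContinuousOn (fun x : ℝ => (1 - u * (1 - x)) ^ (-s)) (Set.Icc 0 1) := by
    refine ContinuousOn.rpow_const (by fun_prop) fun x hx => Or.inl ?_
    nlinarith [hu.1, hu.2, hx.1, hx.2]
  obtain ⟨M, hM⟩ := isCompact_Icc.exists_bound_of_continuousOn hcont
  refine hint.mul_bdd (c := M) ?_ ?_
  · exact (hcont.mono Set.Ioo_subset_Icc_self).aestronglyMeasurable measurableSet_Ioo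
  · exact ae_restrict_of_forall_mem measurableSet_Ioo fun x hx => hM x (Set.Ioo_subset_Icc_self hx)

/-- An Euler-type integral: integrating the weight `x^(r-1) (1-x)^(b-1) ₂F₁(p,q;r;x)` against
`(1-u(1-x))^(-(r+b-q))` gives again a hypergeometric function. -/
theorem integral_kernel (hr : 0 < r) (hb : 0 < b) (hs : 0 < r + b - q)
    (hp : ∀ n : ℕ, r + b - p ≠ -(n : ℝ))
    (hF : ∀ x ∈ Set.Ioo (0 : ℝ) 1, 0 < ordinaryHypergeometric p q r x)
    (hint : IntegrableOn (h r b p q r) (Set.Ioo 0 1)) {u : ℝ} (hu : u ∈ Set.Ioo (0 : ℝ) 1) :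
    ∫ x in Set.Ioo (0 : ℝ) 1, h r b p q r x * (1 - u * (1 - x)) ^ (-(r + b - q)) =
      (∫ x in Set.Ioo (0 : ℝ) 1, h r b p q r x) *
        ordinaryHypergeometric b (r + b - p - q) (r + b - p) u := by
  set s := r + b - q with hs'
  have hu1 : |u| < 1 := abs_lt.2 ⟨by linarith [hu.1], hu.2⟩
  set f : ℕ → ℝ → ℝ := fun n x =>
    (ascPochhammer ℝ n).eval s / n.factorial * u ^ n * h r (b + n) p q r x with hf
  have hpoch : ∀ n : ℕ, 0 ≤ (ascPochhammer ℝ n).eval s / n.factorial * u ^ n := fun n =>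
    mul_nonneg (div_nonneg (ascPochhammer_pos n s hs).le (by positivity))
      (pow_nonneg hu.1.le n)
  have hfint : ∀ n, Integrable (f n) (volume.restrict (Set.Ioo 0 1)) := fun n =>
    (integrableOn_weight_add hint n).const_mul _
  have hfval : ∀ n, ∫ x in Set.Ioo (0 : ℝ) 1, f n x =
      (∫ x in Set.Ioo (0 : ℝ) 1, h r b p q r x) *
        (ordinaryHypergeometricCoefficient b (r + b - p - q) (r + b - p) n * u ^ n) := fun n => by
    rw [integral_const_mul, mul_right_comm,
      integral_weight_add hr hb hp hint n, mul_assoc]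
  -- All terms are nonnegative, so convergence of the target series at u already justifies the
  -- interchange.
  have hfabs : ∀ n, ∫ x in Set.Ioo (0 : ℝ) 1, ‖f n x‖ = ∫ x in Set.Ioo (0 : ℝ) 1, f n x :=
    fun n => setIntegral_congr_fun measurableSet_Ioo fun x hx =>
      Real.norm_of_nonneg (mul_nonneg (hpoch n) (h_pos (hF x hx) hx).le)
  have hJ := (hasSum_ordinaryHypergeometric (p := b) (q := r + b - p - q) hp hu1).mul_left
    (∫ x in Set.Ioo (0 : ℝ) 1, h r b p q r x)
  have hsum : ∀ x ∈ Set.Ioo (0 : ℝ) 1,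
      HasSum (fun n => f n x) (h r b p q r x * (1 - u * (1 - x)) ^ (-s)) := by
    intro x hx
    have h1 : 0 < 1 - x := sub_pos.2 hx.2
    have := (hasSum_one_sub_rpow s (x := u * (1 - x)) (by
      rw [abs_of_pos (mul_pos hu.1 h1)]
      nlinarith [hu.1, hu.2, hx.1])).mul_left (h r b p q r x)
    refine this.congr_fun fun n => ?_
    simp only [hf, h]
    rw [show b + n - 1 = (b - 1) + n by ring, Real.rpow_add_natCast h1.ne', mul_pow]
    ring
  have := hasSum_integral_of_summable_integral_norm hfint
    (by simpa only [hfabs, hfval] using hJ.summable)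
  simp only [hfval] at this
  rw [setIntegral_congr_fun measurableSet_Ioo fun x hx => (hsum x hx).tsum_eq] at this
  exact this.unique hJ

end Kernel

/-! ### From the integral to the law -/

/-- The change of variables `w = (1/u - 1)/x`, that is `u = 1/(1 + w x)`. -/
theorem lintegral_Ioi_eq_lintegral_Ioo {x : ℝ} (hx : 0 < x) (G : ℝ → ENNReal) :
    ∫⁻ w in Set.Ioi (0 : ℝ), G w =
      ∫⁻ u in Set.Ioo (0 : ℝ) 1, ENNReal.ofReal (1 / (u ^ 2 * x)) * G ((u⁻¹ - 1) / x) := by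
  have himg : (fun u : ℝ => (u⁻¹ - 1) / x) '' Set.Ioo 0 1 = Set.Ioi 0 := by
    ext w
    simp only [Set.mem_image, Set.mem_Ioi]
    constructor
    · rintro ⟨u, hu, rfl⟩
      exact div_pos (sub_pos.2 ((one_lt_inv₀ hu.1).2 hu.2)) hx
    · intro hw
      have hwx := mul_pos hw hx
      refine ⟨(1 + w * x)⁻¹, ⟨by positivity, inv_lt_one_of_one_lt₀ (by linarith)⟩, ?_⟩
      rw [inv_inv]
      field_simp
      ring
  have hderiv : ∀ u ∈ Set.Ioo (0 : ℝ) 1,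
      HasDerivWithinAt (fun u : ℝ => (u⁻¹ - 1) / x) (-(u ^ 2)⁻¹ / x) (Set.Ioo 0 1) u :=
    fun u hu => (((hasDerivAt_inv hu.1.ne').sub_const 1).div_const x).hasDerivWithinAt
  have hinj : Set.InjOn (fun u : ℝ => (u⁻¹ - 1) / x) (Set.Ioo 0 1) := by
    intro u _ v _ huv
    have : u⁻¹ - 1 = v⁻¹ - 1 := by
      have := congrArg (· * x) huv
      simpa only [div_mul_cancel₀ _ hx.ne'] using this
    exact inv_injective (by linarith)
  rw [← himg, lintegral_image_eq_lintegral_abs_deriv_mul measurableSet_Ioo hderiv hinj]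
  refine setLIntegral_congr_fun measurableSet_Ioo fun u hu => ?_
  have hu0 := hu.1
  rw [neg_div, abs_neg, abs_of_pos (by positivity), inv_eq_one_div, div_div]

section Law

variable {a b p q r : ℝ}

theorem aemeasurable_ofReal_h (hr : ∀ n : ℕ, r ≠ -(n : ℝ)) :
    AEMeasurable (fun x => ENNReal.ofReal (h a b p q r x)) (volume.restrict (Set.Ioo 0 1)) :=
  ((continuousOn_h hr).aemeasurable measurableSet_Ioo).ennreal_ofReal

theorem BH_univ (a b p q r : ℝ) : BH a b p q r Set.univ =
    (∫⁻ x in Set.Ioo (0 : ℝ) 1, ENNReal.ofReal (h a b p q r x))⁻¹ *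
      ∫⁻ x in Set.Ioo (0 : ℝ) 1, ENNReal.ofReal (h a b p q r x) := by
  rw [BH, Measure.smul_apply, withDensity_apply _ MeasurableSet.univ, smul_eq_mul,
    Measure.restrict_univ]

theorem integrableOn_h_of_isProbabilityMeasure (hr : ∀ n : ℕ, r ≠ -(n : ℝ))
    (hF : ∀ x ∈ Set.Ioo (0 : ℝ) 1, 0 < ordinaryHypergeometric p q r x)
    (hBH : IsProbabilityMeasure (BH a b p q r)) :
    IntegrableOn (h a b p q r) (Set.Ioo 0 1) := by
  have h1 := hBH.measure_univ
  rw [BH_univ] at h1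
  refine ⟨(continuousOn_h hr).aestronglyMeasurable measurableSet_Ioo, ?_⟩
  rw [hasFiniteIntegral_iff_ofReal
    (ae_restrict_of_forall_mem measurableSet_Ioo fun x hx => (h_pos (hF x hx) hx).le)]
  -- An infinite normalising integral has inverse 0, and then `BH` would be the zero measure.
  refine lt_top_iff_ne_top.2 fun htop => ?_
  rw [htop, ENNReal.inv_top, zero_mul] at h1
  exact zero_ne_one h1

theorem integrableOn_h_add_left {d : ℝ} (hd : 0 < d)
    (hint : IntegrableOn (h a b p q r) (Set.Ioo 0 1)) :
    IntegrableOn (h (a + d) b p q r) (Set.Ioo 0 1) := by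
  have : IntegrableOn (fun x => h a b p q r x * x ^ d) (Set.Ioo 0 1) := by
    refine hint.mul_bdd (c := 1) (by fun_prop) ?_
    refine ae_restrict_of_forall_mem measurableSet_Ioo fun x hx => ?_
    rw [Real.norm_of_nonneg (Real.rpow_nonneg hx.1.le _)]
    exact Real.rpow_le_one hx.1.le hx.2.le hd.le
  refine this.congr_fun (fun x hx => ?_) measurableSet_Ioo
  simp only [h]
  rw [show a + d - 1 = (a - 1) + d by ring, Real.rpow_add hx.1]
  ring

/-- Total mass one fixes the constant, so the normalisation of the target law never has to be
evaluated. -/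
theorem eq_BH_of_isProbabilityMeasure {μ : Measure ℝ} (hμ : IsProbabilityMeasure μ)
    {C : ENNReal} (hC : μ = C • (volume.restrict (Set.Ioo (0 : ℝ) 1)).withDensity
      fun x => ENNReal.ofReal (h a b p q r x)) : μ = BH a b p q r := by
  have h1 := hμ.measure_univ
  rw [hC, Measure.smul_apply, withDensity_apply _ MeasurableSet.univ, smul_eq_mul,
    Measure.restrict_univ] at h1
  rw [hC, BH, ENNReal.eq_inv_of_mul_eq_one_left h1]

theorem kernel_identity {c d : ℝ} (hr : r = a + d) (hcd : c + d = r + b - q) {x u : ℝ}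
    (hx : x ∈ Set.Ioo (0 : ℝ) 1) (hu : u ∈ Set.Ioo (0 : ℝ) 1) :
    h a b p q r x * (1 / (u ^ 2 * x) * (1 / beta c d *
      (((u⁻¹ - 1) / x) ^ (c - 1) / (1 + (u⁻¹ - 1) / x) ^ (c + d)))) =
    1 / beta c d * (u ^ (d - 1) * (1 - u) ^ (c - 1)) *
      (h r b p q r x * (1 - u * (1 - x)) ^ (-(r + b - q))) := by
  obtain ⟨hx0, hx1⟩ := hx
  obtain ⟨hu0, hu1⟩ := hu
  have hu' : 0 < 1 - u := sub_pos.2 hu1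
  have hk : 0 < 1 - u * (1 - x) := by nlinarith
  rw [show (u⁻¹ - 1) / x = (1 - u) / (u * x) by field_simp,
    show 1 + (1 - u) / (u * x) = (1 - u * (1 - x)) / (u * x) by field_simp; ring,
    Real.div_rpow hu'.le (by positivity), Real.div_rpow hk.le (by positivity),
    Real.mul_rpow hu0.le hx0.le, Real.mul_rpow hu0.le hx0.le, ← hcd, Real.rpow_neg hk.le]
  simp only [h]
  have e1 : x ^ (r - 1) * x ^ (c - 1) * x = x ^ (a - 1) * x ^ (c + d) := by
    rw [← Real.rpow_add hx0, ← Real.rpow_add_one hx0.ne', ← Real.rpow_add hx0, hr]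
    congr 1; ring
  have e2 : u ^ (d - 1) * u ^ (c - 1) * u ^ 2 = u ^ (c + d) := by
    rw [← Real.rpow_add hu0, ← Real.rpow_add_natCast hu0.ne']
    congr 1; push_cast; ring
  have hk' := (Real.rpow_pos_of_pos hk (c + d)).ne'
  have hxc := (Real.rpow_pos_of_pos hx0 (c - 1)).ne'
  have huc := (Real.rpow_pos_of_pos hu0 (c - 1)).ne'
  have hxcd := (Real.rpow_pos_of_pos hx0 (c + d)).ne'
  have hucd := (Real.rpow_pos_of_pos hu0 (c + d)).ne'
  generalize ordinaryHypergeometric p q r x = F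
  generalize (1 - u * (1 - x)) ^ (c + d) = K at *
  generalize (1 - x) ^ (b - 1) = L at *
  generalize (1 - u) ^ (c - 1) = M at *
  generalize beta c d = B at *
  rw [← e2]
  have e3 : x ^ (r - 1) = x ^ (a - 1) * x ^ (c + d) / (x ^ (c - 1) * x) := by
    field_simp
    linear_combination e1
  rw [e3]
  field_simp

/-- Supplies the conditional law of 1/(1+WX) given X = x, in the coordinate u. -/
theorem betaTwo_preimage {c d x : ℝ} (hx : 0 < x) {S : Set ℝ} (hS : MeasurableSet S) :
    betaTwo c d ((fun w => 1 / (1 + w * x)) ⁻¹' S) =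
      ∫⁻ u in Set.Ioo (0 : ℝ) 1, ENNReal.ofReal (1 / (u ^ 2 * x) * (1 / beta c d *
        (((u⁻¹ - 1) / x) ^ (c - 1) / (1 + (u⁻¹ - 1) / x) ^ (c + d)))) * S.indicator 1 u := by
  have hA : MeasurableSet ((fun w : ℝ => 1 / (1 + w * x)) ⁻¹' S) := by
    have : Measurable fun w : ℝ => 1 / (1 + w * x) := by fun_prop
    exact this hS
  rw [betaTwo, withDensity_apply _ hA, ← lintegral_indicator hA,
    lintegral_Ioi_eq_lintegral_Ioo hx]
  refine setLIntegral_congr_fun measurableSet_Ioo fun u hu => ?_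
  have hu0 := hu.1
  have hinv : 1 / (1 + (u⁻¹ - 1) / x * x) = u := by
    rw [div_mul_cancel₀ _ hx.ne', add_sub_cancel, one_div, inv_inv]
  by_cases huS : u ∈ S
  · rw [Set.indicator_of_mem (by rwa [Set.mem_preimage, hinv]), Set.indicator_of_mem huS,
      ENNReal.ofReal_mul (p := 1 / (u ^ 2 * x)) (by positivity), Pi.one_apply, mul_one]
  · rw [Set.indicator_of_notMem (by rwa [Set.mem_preimage, hinv]), Set.indicator_of_notMem huS,
      mul_zero, mul_zero]

/-- The law of `1 / (1 + W X)` for independent `W ∼ β⁽²⁾_{c,d}` and `X ∼ BH(a,b,p,q,r)`. -/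
theorem hasLaw_one_div_one_add_mul {Ω : Type*} [MeasurableSpace Ω] {P : Measure Ω}
    [IsProbabilityMeasure P] {c d : ℝ} (hadm : Admissible a b p q r) (hc : 0 < c) (hd : 0 < d)
    (hrd : r = a + d) (hcd : c + d = r + b - q) {X W : Ω → ℝ}
    (hX : HasLaw X (BH a b p q r) P) (hW : HasLaw W (betaTwo c d) P) (hind : IndepFun W X P) :
    Admissible d c b (r + b - p - q) (r + b - p) ∧
      HasLaw (fun ω => 1 / (1 + W ω * X ω)) (BH d c b (r + b - p - q) (r + b - p)) P := by
  obtain ⟨hr, hF, ha, hb, hm⟩ := hadm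
  have hm' : 0 < r + b - p - q := by linarith
  have hPX : IsProbabilityMeasure (BH a b p q r) := hX.isProbabilityMeasure_iff.1 ‹_›
  have hPW : IsProbabilityMeasure (betaTwo c d) := hW.isProbabilityMeasure_iff.1 ‹_›
  have hr0 : 0 < r := by linarith
  -- Raising the exponent of x from a-1 to r-1 = a+d-1 only multiplies by the bounded factor x^d.
  have hint : IntegrableOn (h r b p q r) (Set.Ioo 0 1) := by
    have := integrableOn_h_add_left hd (integrableOn_h_of_isProbabilityMeasure hr hF hPX)
    rwa [← hrd] at this
  have hs : 0 < r + b - q := by linarith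
  have hp := ne_neg_natCast_of_weight hr0 hb hm' hF hint
  set J := ∫ x in Set.Ioo (0 : ℝ) 1, h r b p q r x with hJdef
  have hJ : 0 < J := by simpa using integral_weight_pos hF hint 0
  have hker := fun {u : ℝ} (hu : u ∈ Set.Ioo (0 : ℝ) 1) =>
    integral_kernel hr0 hb hs hp hF hint hu
  have hkpos : ∀ u ∈ Set.Ioo (0 : ℝ) 1, ∀ x ∈ Set.Ioo (0 : ℝ) 1,
      0 < h r b p q r x * (1 - u * (1 - x)) ^ (-(r + b - q)) := fun u hu x hx =>
    mul_pos (h_pos (hF x hx) hx)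
      (Real.rpow_pos_of_pos (by nlinarith [hu.1, hu.2, hx.1, hx.2]) _)
  have hF' : ∀ u ∈ Set.Ioo (0 : ℝ) 1,
      0 < ordinaryHypergeometric b (r + b - p - q) (r + b - p) u := fun u hu => by
    have := setIntegral_Ioo_pos (hkpos u hu) (integrableOn_kernel hint hu)
    rw [hker hu] at this
    exact pos_of_mul_pos_right this hJ.le
  refine ⟨⟨hp, hF', hd, hc, by linarith⟩, ?_⟩
  have hφ : Measurable fun z : ℝ × ℝ => 1 / (1 + z.1 * z.2) := by fun_prop
  have hWX : AEMeasurable (fun ω => (W ω, X ω)) P := hW.aemeasurable.prodMk hX.aemeasurable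
  have haem : AEMeasurable (fun ω => 1 / (1 + W ω * X ω)) P := hφ.comp_aemeasurable hWX
  refine ⟨haem, ?_⟩
  have hprob : IsProbabilityMeasure (P.map fun ω => 1 / (1 + W ω * X ω)) :=
    Measure.isProbabilityMeasure_map haem
  set Z := ∫⁻ x in Set.Ioo (0 : ℝ) 1, ENNReal.ofReal (h a b p q r x) with hZ
  refine eq_BH_of_isProbabilityMeasure hprob
    (C := Z⁻¹ * ENNReal.ofReal (1 / beta c d * J)) ?_
  have hmap : P.map (fun ω => 1 / (1 + W ω * X ω)) =
      ((betaTwo c d).prod (BH a b p q r)).map fun z => 1 / (1 + z.1 * z.2) := by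
    rw [← hW.map_eq, ← hX.map_eq,
      ← (indepFun_iff_map_prod_eq_prod_map_map hW.aemeasurable hX.aemeasurable).1 hind,
      AEMeasurable.map_map_of_aemeasurable hφ.aemeasurable hWX]
    rfl
  ext S hS
  rw [hmap, Measure.map_apply hφ hS, Measure.prod_apply_symm (hφ hS), BH, ← hZ,
    lintegral_smul_measure,
    lintegral_withDensity_eq_lintegral_mul₀ (aemeasurable_ofReal_h hr)
      (measurable_measure_prodMk_right (hφ hS)).aemeasurable, smul_eq_mul, Measure.smul_apply,
    withDensity_apply _ hS, smul_eq_mul, mul_assoc]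
  congr 1
  have hB := beta_pos hc hd
  have hstep : ∀ x ∈ Set.Ioo (0 : ℝ) 1, ENNReal.ofReal (h a b p q r x) *
      betaTwo c d ((fun w => (w, x)) ⁻¹' ((fun z : ℝ × ℝ => 1 / (1 + z.1 * z.2)) ⁻¹' S)) =
      ∫⁻ u in Set.Ioo (0 : ℝ) 1, S.indicator 1 u *
        (ENNReal.ofReal (1 / beta c d * (u ^ (d - 1) * (1 - u) ^ (c - 1))) *
        ENNReal.ofReal (h r b p q r x * (1 - u * (1 - x)) ^ (-(r + b - q)))) := by
    intro x hx
    refine (congrArg _ (betaTwo_preimage hx.1 hS)).trans ?_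
    rw [← lintegral_const_mul' _ _ ENNReal.ofReal_ne_top]
    refine setLIntegral_congr_fun measurableSet_Ioo fun u hu => ?_
    have hu1 : 0 < 1 - u := sub_pos.2 hu.2
    have hu0 := hu.1
    rw [← mul_assoc, ← ENNReal.ofReal_mul (h_pos (hF x hx) hx).le, kernel_identity hrd hcd hx hu,
      ENNReal.ofReal_mul (by positivity), mul_comm]
  have hmeas : AEMeasurable (Function.uncurry fun x u : ℝ => S.indicator (1 : ℝ → ENNReal) u *
        (ENNReal.ofReal (1 / beta c d * (u ^ (d - 1) * (1 - u) ^ (c - 1))) *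
        ENNReal.ofReal (h r b p q r x * (1 - u * (1 - x)) ^ (-(r + b - q)))))
      ((volume.restrict (Set.Ioo (0 : ℝ) 1)).prod (volume.restrict (Set.Ioo (0 : ℝ) 1))) := by
    have h1 : Measurable (S.indicator (1 : ℝ → ENNReal)) := measurable_one.indicator hS
    have h2 : AEMeasurable (h r b p q r) (volume.restrict (Set.Ioo 0 1)) :=
      (continuousOn_h hr).aemeasurable measurableSet_Ioo
    refine (h1.comp measurable_snd).aemeasurable.mul (AEMeasurable.fun_mul ?_ ?_)
    · exact Measurable.aemeasurable (by fun_prop)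
    · refine AEMeasurable.ennreal_ofReal (AEMeasurable.fun_mul h2.comp_fst ?_)
      exact Measurable.aemeasurable (by fun_prop)
  refine (setLIntegral_congr_fun measurableSet_Ioo hstep).trans ?_
  -- By Tonelli, x is integrated out first for fixed u, where `hker` applies.
  rw [lintegral_lintegral_swap hmeas, ← lintegral_const_mul' _ _ ENNReal.ofReal_ne_top,
    ← lintegral_indicator hS]
  refine setLIntegral_congr_fun measurableSet_Ioo fun u hu => ?_
  have hu1 : 0 < 1 - u := sub_pos.2 hu.2
  have hu0 := hu.1
  by_cases huS : u ∈ S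
  · simp only [Set.indicator_of_mem huS, Pi.one_apply, one_mul]
    rw [lintegral_const_mul' _ _ ENNReal.ofReal_ne_top,
      ← ofReal_integral_eq_lintegral_ofReal (integrableOn_kernel hint hu)
        (ae_restrict_of_forall_mem measurableSet_Ioo fun x hx => (hkpos u hu x hx).le), hker hu,
      ← ENNReal.ofReal_mul (by positivity), ← ENNReal.ofReal_mul (by positivity)]
    rw [← hJdef]
    congr 1
    simp only [h]
    ring
  · simp [Set.indicator_of_notMem huS]

end Law

/-! ### Symmetries of the parameters -/

theorem Admissible.symm {a b p q r : ℝ} (hadm : Admissible a b p q r) :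
    Admissible a b q p r := by
  obtain ⟨hr, hF, ha, hb, hm⟩ := hadm
  exact ⟨hr, by rwa [ordinaryHypergeometric_symm], ha, hb, by linarith⟩

theorem BH_symm (a b p q r : ℝ) : BH a b p q r = BH a b q p r := by
  unfold BH h
  rw [ordinaryHypergeometric_symm]

/-- The transformation exchanges b and r+b-p-q, so their positivity conditions trade places. -/
theorem Admissible.euler {a b p q r : ℝ} (hadm : Admissible a b p q r) :
    Admissible a (r + b - p - q) (r - p) (r - q) r := by
  obtain ⟨hr, hF, ha, hb, hm⟩ := hadm
  refine ⟨hr, fun x hx => ?_, ha, by linarith, by linarith⟩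
  rw [ordinaryHypergeometric_euler hr (abs_lt.2 ⟨by linarith [hx.1], hx.2⟩)]
  exact mul_pos (Real.rpow_pos_of_pos (sub_pos.2 hx.2) _) (hF x hx)

theorem BH_euler {a b p q r : ℝ} (hr : ∀ n : ℕ, r ≠ -(n : ℝ)) :
    BH a (r + b - p - q) (r - p) (r - q) r = BH a b p q r := by
  have heq : ∀ x ∈ Set.Ioo (0 : ℝ) 1,
      ENNReal.ofReal (h a (r + b - p - q) (r - p) (r - q) r x) =
        ENNReal.ofReal (h a b p q r x) := fun x hx => by
    congr 1
    simp only [h]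
    rw [ordinaryHypergeometric_euler hr (abs_lt.2 ⟨by linarith [hx.1], hx.2⟩),
      show b - 1 = (r + b - p - q - 1) + (p + q - r) by ring,
      Real.rpow_add (sub_pos.2 hx.2)]
    ring
  rw [BH, BH, setLIntegral_congr_fun measurableSet_Ioo heq,
    withDensity_congr_ae (ae_restrict_of_forall_mem measurableSet_Ioo heq)]

section Theta

variable {θ₁ θ₂ θ₃ θ₄ θ₅ : ℝ}

theorem AdmissibleTheta.swap₄₅ (hθ : AdmissibleTheta θ₁ θ₂ θ₃ θ₄ θ₅) :
    AdmissibleTheta θ₁ θ₂ θ₃ θ₅ θ₄ := by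
  have := Admissible.symm hθ
  rwa [add_comm θ₄ θ₅, add_right_comm _ θ₄ θ₅] at this

theorem BHTheta_swap₄₅ (θ₁ θ₂ θ₃ θ₄ θ₅ : ℝ) :
    BHTheta θ₁ θ₂ θ₃ θ₅ θ₄ = BHTheta θ₁ θ₂ θ₃ θ₄ θ₅ := by
  rw [BHTheta, BHTheta, BH_symm, add_comm θ₄ θ₅, add_right_comm _ θ₄ θ₅]

theorem AdmissibleTheta.swap₂₃ (hθ : AdmissibleTheta θ₁ θ₂ θ₃ θ₄ θ₅) :
    AdmissibleTheta θ₁ θ₃ θ₂ θ₄ θ₅ := by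
  have := (Admissible.euler hθ).symm
  rw [AdmissibleTheta]
  convert this using 1 <;> ring

theorem BHTheta_swap₂₃ (hθ : AdmissibleTheta θ₁ θ₂ θ₃ θ₄ θ₅) :
    BHTheta θ₁ θ₃ θ₂ θ₄ θ₅ = BHTheta θ₁ θ₂ θ₃ θ₄ θ₅ := by
  rw [BHTheta, BHTheta, ← BH_euler hθ.1, BH_symm]
  congr 1 <;> ring

theorem hasBHLaw_of_hasLaw {Ω : Type*} [MeasurableSpace Ω] {P : Measure Ω} {Y : Ω → ℝ}
    (hθ : AdmissibleTheta θ₁ θ₂ θ₃ θ₄ θ₅) (hY : HasLaw Y (BHTheta θ₁ θ₂ θ₃ θ₄ θ₅) P) :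
    HasBHLaw Y P θ₁ s(θ₂, θ₃) s(θ₄, θ₅) := by
  intro y z u v hs ht
  rcases Sym2.eq_iff.1 hs with ⟨rfl, rfl⟩ | ⟨rfl, rfl⟩ <;>
    rcases Sym2.eq_iff.1 ht with ⟨rfl, rfl⟩ | ⟨rfl, rfl⟩
  · exact ⟨hθ, hY⟩
  · exact ⟨hθ.swap₄₅, by rwa [BHTheta_swap₄₅]⟩
  · exact ⟨hθ.swap₂₃, by rwa [BHTheta_swap₂₃ hθ]⟩
  · exact ⟨hθ.swap₂₃.swap₄₅, by rwa [BHTheta_swap₄₅, BHTheta_swap₂₃ hθ]⟩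

theorem hasBHLaw_one_div_one_add_mul {Ω : Type*} [MeasurableSpace Ω] {P : Measure Ω}
    [IsProbabilityMeasure P] (hθ : AdmissibleTheta θ₁ θ₂ θ₃ θ₄ θ₅) (h₂₃ : 0 < θ₂ + θ₃)
    (h₁₅ : 0 < θ₁ + θ₅) {X W : Ω → ℝ} (hX : HasLaw X (BHTheta θ₁ θ₂ θ₃ θ₄ θ₅) P)
    (hW : HasLaw W (betaTwo (θ₁ + θ₅) (θ₂ + θ₃)) P) (hind : IndepFun W X P) :
    HasBHLaw (fun ω => 1 / (1 + W ω * X ω)) P θ₅ s(θ₁, θ₄) s(θ₂, θ₃) := by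
  have key := hasLaw_one_div_one_add_mul hθ h₁₅ h₂₃ (by ring) (by ring) hX hW hind
  rw [show θ₂ + θ₃ + θ₄ + θ₅ + (θ₁ + θ₃) - (θ₃ + θ₅) - (θ₃ + θ₄) = θ₁ + θ₂ by ring,
    show θ₂ + θ₃ + θ₄ + θ₅ + (θ₁ + θ₃) - (θ₃ + θ₅) = θ₄ + θ₁ + θ₂ + θ₃ by ring,
    add_comm θ₁ θ₅] at key
  rw [Sym2.eq_swap (a := θ₁)]
  exact hasBHLaw_of_hasLaw (by rw [AdmissibleTheta]; convert key.1 using 1)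
    (by rw [BHTheta]; convert key.2 using 2)

end Theta

end BetaHypergeometric

theorem theorem3p3 {Ω : Type*} [MeasurableSpace Ω] (P : Measure Ω) [IsProbabilityMeasure P]
    (θ₁ θ₂ θ₃ θ₄ θ₅ : ℝ) (hθ : BetaHypergeometric.AdmissibleTheta θ₁ θ₂ θ₃ θ₄ θ₅)
    (h₂₃ : 0 < θ₂ + θ₃) (X : Ω → ℝ)
    (hX : HasLaw X (BetaHypergeometric.BHTheta θ₁ θ₂ θ₃ θ₄ θ₅) P) :
    (0 < θ₁ + θ₅ → ∀ W : Ω → ℝ,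
      HasLaw W (BetaHypergeometric.betaTwo (θ₁ + θ₅) (θ₂ + θ₃)) P → IndepFun W X P →
      BetaHypergeometric.HasBHLaw (fun ω => 1 / (1 + W ω * X ω)) P θ₅ s(θ₁, θ₄) s(θ₂, θ₃)) ∧
    (0 < θ₁ + θ₄ → ∀ W' : Ω → ℝ,
      HasLaw W' (BetaHypergeometric.betaTwo (θ₁ + θ₄) (θ₂ + θ₃)) P → IndepFun W' X P →
      BetaHypergeometric.HasBHLaw (fun ω => 1 / (1 + W' ω * X ω)) P θ₄ s(θ₁, θ₅) s(θ₂, θ₃)) := by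
  refine ⟨fun h₁₅ W hW hind =>
    BetaHypergeometric.hasBHLaw_one_div_one_add_mul hθ h₂₃ h₁₅ hX hW hind,
    fun h₁₄ W hW hind => ?_⟩
  rw [← BetaHypergeometric.BHTheta_swap₄₅] at hX
  exact BetaHypergeometric.hasBHLaw_one_div_one_add_mul hθ.swap₄₅ h₂₃ h₁₄ hX hW hind
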